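/- Let $K$ be an algebraically closed field and let $r \ge 2$ be an integer. Let $\Lambda = KQ/I$, where $Q$ is the quiver with a single vertex and $r$ distinct loops $\alpha_1,\dots,\alpha_r$, so that the path algebra $KQ$ is the free associative $K$-algebra $K\langle \alpha_1,\dots,\alpha_r\rangle$, and where $I$ is the ideal generated by all paths of length $2$, i.e. by all products $\alpha_i\alpha_j$ with $1 \le i,j \le r$. For $d \ge 1$ let $\operatorname{Rep}_d(\Lambda)$ be the affine variety of all $r$-tuples $(x_1,\dots,x_r)$ of $d\times d$ matrices over $K$ that satisfy all relations in $I$, that is, $x_i x_j = 0$ for all $i,j$, endowed with the Zariski topology. Then for every integer $d \ge 2$ the variety $\operatorname{Rep}_d(\Lambda)$ has exactly $$d - 2\left\lceil \frac{d}{r+1}\right\rceil + 1$$ irreducible components. -/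

import Mathlib

/-- The Zariski topology on affine space `K^σ` (as a set of `K`-points): the closed sets are
the common zero loci of sets (equivalently, ideals) of polynomials. -/
@[reducible]
def zariskiTopology (σ K : Type*) [Field K] : TopologicalSpace (σ → K) :=
  TopologicalSpace.ofClosed
    {Z | ∃ I : Ideal (MvPolynomial σ K), Z = MvPolynomial.zeroLocus K I}
    ⟨⊤, MvPolynomial.zeroLocus_top.symm⟩
    (by
      intro A hA
      refine ⟨sSup {I : Ideal (MvPolynomial σ K) | MvPolynomial.zeroLocus K I ∈ A}, ?_⟩
      ext x
      have key : x ∈ MvPolynomial.zeroLocus K (sSup {I : Ideal (MvPolynomial σ K) | MvPolynomial.zeroLocus K I ∈ A}) ↔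
          sSup {I : Ideal (MvPolynomial σ K) | MvPolynomial.zeroLocus K I ∈ A} ≤
            MvPolynomial.vanishingIdeal K ({x} : Set (σ → K)) := by
        rw [← MvPolynomial.le_zeroLocus_iff_le_vanishingIdeal]
        simp
      rw [key, sSup_le_iff, Set.mem_sInter]
      constructor
      · intro h I hI
        rw [← MvPolynomial.le_zeroLocus_iff_le_vanishingIdeal]
        simpa using h _ hI
      · intro h Z hZ
        obtain ⟨I, rfl⟩ := hA hZ
        have := h I hZ
        rw [← MvPolynomial.le_zeroLocus_iff_le_vanishingIdeal] at this
        simpa using this)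
    (by
      rintro _ ⟨I, rfl⟩ _ ⟨J, rfl⟩
      refine ⟨I * J, Set.Subset.antisymm ?_ ?_⟩
      · rintro x (h | h)
        · exact MvPolynomial.zeroLocus_anti_mono Ideal.mul_le_left h
        · exact MvPolynomial.zeroLocus_anti_mono Ideal.mul_le_right h
      · intro x h
        by_contra hx
        rw [Set.mem_union, not_or] at hx
        simp only [MvPolynomial.mem_zeroLocus_iff, not_forall] at hx h
        obtain ⟨⟨p, hp, hp0⟩, ⟨q, hq, hq0⟩⟩ := hx
        have := h (p * q) (Ideal.mul_mem_mul hp hq)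
        rw [map_mul] at this
        exact (mul_ne_zero hp0 hq0) this)

/-- The path algebra `KQ` of the quiver `Q` with a single vertex and `r` distinct loops
`α_0, …, α_{r-1}`: the paths are the words in the loops (the trivial path is the unit), so `KQ`
is the free associative unital `K`-algebra on the loops. -/
abbrev LoopPathAlgebra (K : Type*) [Field K] (r : ℕ) : Type _ := FreeAlgebra K (Fin r)

/-- The ideal of `KQ` generated by all paths of length `2`. -/
def lengthTwoIdeal (K : Type*) [Field K] (r : ℕ) : TwoSidedIdeal (LoopPathAlgebra K r) :=
  TwoSidedIdeal.span {p | ∃ i j : Fin r, p = FreeAlgebra.ι K i * FreeAlgebra.ι K j}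

/-- The set of points of the module variety `Rep_d(KQ/I)`, `Q` the quiver with one vertex and `r`
loops: families `x = (x_α)` of `d × d` matrices, one for each loop, that satisfy all relations
in the ideal `I`. -/
def ModuleVariety {K : Type*} [Field K] {r : ℕ} (I : TwoSidedIdeal (LoopPathAlgebra K r))
    (d : ℕ) : Type _ :=
  {x : Fin r → Matrix (Fin d) (Fin d) K // ∀ p ∈ I, FreeAlgebra.lift K x p = 0}

/-- The matrix entries of a point, as a point of affine space of dimension `r * d * d`. -/
def ModuleVariety.coords {K : Type*} [Field K] {r : ℕ}
    {I : TwoSidedIdeal (LoopPathAlgebra K r)} {d : ℕ} (x : ModuleVariety I d) :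
    Fin r × Fin d × Fin d → K :=
  fun t => x.1 t.1 t.2.1 t.2.2

/-- `Rep_d(KQ/I)` carries the Zariski topology, i.e. the subspace topology from the affine
space of all matrix entries. -/
instance ModuleVariety.instTopologicalSpace {K : Type*} [Field K] {r : ℕ}
    (I : TwoSidedIdeal (LoopPathAlgebra K r)) (d : ℕ) : TopologicalSpace (ModuleVariety I d) :=
  TopologicalSpace.induced ModuleVariety.coords (zariskiTopology (Fin r × Fin d × Fin d) K)

/-! For a point `x`, let `R` be the sum of the images of the `x k` and `N` the intersection of their
kernels; the relations say `R ≤ N`. Let `Z_s` be the range of `blockParam r d s`. It is irreducible,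
as a polynomial image of affine space, and it contains every `x` with `R ≤ W ≤ N` for some `W` of
dimension `s` (`mem_range_blockParam`). Put `c = ⌈d/(r+1)⌉`. Rank estimates on `R` and `N` always
leave room for such a `W` with `c ≤ s ≤ d - c`, so these `Z_s` cover the variety
(`exists_mem_range_blockParam`). On `Z_t` the matrices placed side by side have rank at most `t`,
and stacked they have rank at most `d - t`; both are closed conditions on minors. For `c ≤ s ≤ d -
c` some point of `Z_s` attains ranks `s` and `d - s`, so no `Z_s` lies in the closure of another
(`eq_of_range_blockParam_subset_closure`). The components are thus the `d - 2c + 1` closures. -/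

/-! ### Components from a finite irreducible cover -/

theorem irreducibleComponents_eq_image_closure {X ι : Type*} [TopologicalSpace X]
    (S : Finset ι) (Z : ι → Set X) (hirr : ∀ s ∈ S, IsIrreducible (Z s))
    (hcover : ∀ x, ∃ s ∈ S, x ∈ Z s)
    (hsub : ∀ s ∈ S, ∀ t ∈ S, Z s ⊆ closure (Z t) → s = t) :
    irreducibleComponents X = (fun s => closure (Z s)) '' (S : Set ι) := by
  -- An irreducible set covered by finitely many closed sets lies in one of them.
  have key : ∀ T : Set X, IsIrreducible T → ∃ t ∈ S, T ⊆ closure (Z t) := by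
    classical
    intro T hT
    obtain ⟨z, hz, hTz⟩ := isIrreducible_iff_sUnion_isClosed.1 hT
      (S.image fun s => closure (Z s))
      (by
        intro z hz
        obtain ⟨s, -, rfl⟩ := Finset.mem_image.1 hz
        exact isClosed_closure)
      (by
        intro x _
        obtain ⟨s, hs, hx⟩ := hcover x
        exact Set.mem_sUnion.2
          ⟨_, Finset.mem_coe.2 (Finset.mem_image_of_mem _ hs), subset_closure hx⟩)
    obtain ⟨s, hs, rfl⟩ := Finset.mem_image.1 hz
    exact ⟨s, hs, hTz⟩
  ext T
  constructor
  · intro hT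
    obtain ⟨t, ht, hTt⟩ := key T hT.1
    exact ⟨t, ht, Set.Subset.antisymm (hT.2 (hirr t ht).closure hTt) hTt⟩
  · rintro ⟨s, hs, rfl⟩
    refine ⟨(hirr s hs).closure, fun T hT hsT => ?_⟩
    obtain ⟨t, ht, hTt⟩ := key T hT
    obtain rfl := hsub s hs t ht (subset_closure.trans (hsT.trans hTt))
    exact hTt

theorem ncard_irreducibleComponents_eq_card {X ι : Type*} [TopologicalSpace X]
    (S : Finset ι) (Z : ι → Set X) (hirr : ∀ s ∈ S, IsIrreducible (Z s))
    (hcover : ∀ x, ∃ s ∈ S, x ∈ Z s)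
    (hsub : ∀ s ∈ S, ∀ t ∈ S, Z s ⊆ closure (Z t) → s = t) :
    (irreducibleComponents X).Finite ∧ (irreducibleComponents X).ncard = S.card := by
  rw [irreducibleComponents_eq_image_closure S Z hirr hcover hsub]
  refine ⟨S.finite_toSet.image _, ?_⟩
  rw [Set.InjOn.ncard_image, Set.ncard_coe_finset]
  intro s hs t ht h
  exact hsub s hs t ht (subset_closure.trans h.subset)

/-! ### Zariski topology and the module variety -/

theorem isClosed_zariskiTopology_iff {σ K : Type*} [Field K] {Z : Set (σ → K)} :
    @IsClosed _ (zariskiTopology σ K) Z ↔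
      ∃ I : Ideal (MvPolynomial σ K), Z = MvPolynomial.zeroLocus K I := by
  rw [← @isOpen_compl_iff _ _ (zariskiTopology σ K)]
  change Zᶜᶜ ∈ _ ↔ _
  rw [compl_compl]
  rfl

theorem isClosed_setOf_aeval_eq_zero {σ K : Type*} [Field K] (p : MvPolynomial σ K) :
    @IsClosed _ (zariskiTopology σ K) {x | MvPolynomial.aeval x p = 0} := by
  refine isClosed_zariskiTopology_iff.2 ⟨Ideal.span {p}, ?_⟩
  rw [MvPolynomial.zeroLocus_span]
  simp

theorem continuous_aeval_zariskiTopology {σ τ K : Type*} [Field K] (P : τ → MvPolynomial σ K) :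
    @Continuous _ _ (zariskiTopology σ K) (zariskiTopology τ K)
      (fun x t => MvPolynomial.aeval x (P t)) := by
  let _ := zariskiTopology σ K
  let _ := zariskiTopology τ K
  refine continuous_iff_isClosed.2 fun Z hZ => ?_
  obtain ⟨I, rfl⟩ := isClosed_zariskiTopology_iff.1 hZ
  have : (fun x t => MvPolynomial.aeval x (P t)) ⁻¹' MvPolynomial.zeroLocus K I =
      ⋂ p ∈ I, {x : σ → K | MvPolynomial.aeval x (MvPolynomial.bind₁ P p) = 0} := by
    ext x
    simp [MvPolynomial.aeval_bind₁]
  rw [this]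
  exact isClosed_biInter fun p _ => isClosed_setOf_aeval_eq_zero _

theorem isIrreducible_univ_zariskiTopology (σ K : Type*) [Field K] [Infinite K] :
    @IsIrreducible _ (zariskiTopology σ K) Set.univ := by
  let _ := zariskiTopology σ K
  have basic : ∀ U : Set (σ → K), IsOpen U → U.Nonempty → ∃ p : MvPolynomial σ K, p ≠ 0 ∧
      ∀ x, MvPolynomial.aeval x p ≠ 0 → x ∈ U := by
    intro U hU ⟨x, hx⟩
    obtain ⟨I, hI⟩ := isClosed_zariskiTopology_iff.1 hU.isClosed_compl
    have hx' : x ∉ MvPolynomial.zeroLocus K I := hI ▸ not_not.2 hx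
    simp only [MvPolynomial.mem_zeroLocus_iff, not_forall] at hx'
    obtain ⟨p, hp, hpx⟩ := hx'
    refine ⟨p, fun h => hpx (by simp [h]), fun y hy => ?_⟩
    by_contra hyU
    have : y ∈ MvPolynomial.zeroLocus K I := hI ▸ hyU
    exact hy (this p hp)
  refine ⟨⟨0, trivial⟩, ?_⟩
  rintro U V hU hV ⟨x, -, hx⟩ ⟨y, -, hy⟩
  obtain ⟨p, hp, hpU⟩ := basic U hU ⟨x, hx⟩
  obtain ⟨q, hq, hqV⟩ := basic V hV ⟨y, hy⟩
  -- Over an infinite field the nonzero polynomial `p * q` does not vanish identically.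
  have : ∃ z : σ → K, MvPolynomial.eval z (p * q) ≠ 0 := by
    by_contra! h
    exact mul_ne_zero hp hq (MvPolynomial.funext fun z => by rw [h z, map_zero])
  obtain ⟨z, hz⟩ := this
  rw [map_mul] at hz
  exact ⟨z, trivial, hpU z (by simpa [MvPolynomial.aeval_eq_eval] using left_ne_zero_of_mul hz),
    hqV z (by simpa [MvPolynomial.aeval_eq_eval] using right_ne_zero_of_mul hz)⟩

theorem forall_mem_lengthTwoIdeal_lift_eq_zero_iff {K A : Type*} [Field K] [Ring A] [Algebra K A]
    {r : ℕ} (x : Fin r → A) :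
    (∀ p ∈ lengthTwoIdeal K r, FreeAlgebra.lift K x p = 0) ↔ ∀ i j, x i * x j = 0 := by
  constructor
  · intro h i j
    simpa using h _ (TwoSidedIdeal.subset_span ⟨i, j, rfl⟩)
  · intro h p hp
    have hle : lengthTwoIdeal K r ≤ TwoSidedIdeal.ker (FreeAlgebra.lift K x) := by
      refine TwoSidedIdeal.span_le.2 ?_
      rintro _ ⟨i, j, rfl⟩
      simp [TwoSidedIdeal.mem_ker, h]
    exact (TwoSidedIdeal.mem_ker _).1 (hle hp)

theorem isClosed_setOf_det_coords_eq_zero {K : Type*} [Field K] {r d n : ℕ}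
    (I : TwoSidedIdeal (LoopPathAlgebra K r)) (f : Fin n → Fin n → Fin r × Fin d × Fin d) :
    IsClosed {x : ModuleVariety I d | (Matrix.of fun i j => x.coords (f i j)).det = 0} := by
  let _ := zariskiTopology (Fin r × Fin d × Fin d) K
  have h := (isClosed_setOf_aeval_eq_zero (K := K)
    (Matrix.of fun i j => MvPolynomial.X (f i j)).det).preimage
    (continuous_induced_dom : Continuous (ModuleVariety.coords (I := I) (d := d)))
  refine (congrArg IsClosed (Set.ext fun x => ?_)).mpr h
  change _ = 0 ↔ MvPolynomial.aeval x.coords _ = 0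
  rw [AlgHom.map_det]
  congr! 2
  ext
  simp

/-! ### Dimension counts and adapted bases -/

theorem Submodule.exists_le_le_finrank_eq {K V : Type*} [Field K] [AddCommGroup V] [Module K V]
    [FiniteDimensional K V] {R N : Submodule K V} (hRN : R ≤ N) {s : ℕ}
    (hR : Module.finrank K R ≤ s) (hN : s ≤ Module.finrank K N) :
    ∃ W, R ≤ W ∧ W ≤ N ∧ Module.finrank K W = s := by
  induction s, hR using Nat.le_induction with
  | base => exact ⟨R, le_rfl, hRN, rfl⟩
  | succ s _ ih =>
    obtain ⟨W, hRW, hWN, hW⟩ := ih (by omega)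
    obtain ⟨v, hvN, hvW⟩ : ∃ v ∈ N, v ∉ W := by
      by_contra! h
      have := Submodule.finrank_mono (show N ≤ W from h)
      omega
    refine ⟨W ⊔ Submodule.span K {v}, hRW.trans le_sup_left,
      sup_le hWN ((Submodule.span_singleton_le_iff_mem _ _).2 hvN), ?_⟩
    rw [Submodule.finrank_sup_span_singleton hvW, hW]

theorem Submodule.finrank_finsetSup_le {K V ι : Type*} [Field K] [AddCommGroup V] [Module K V]
    [FiniteDimensional K V] (S : Finset ι) (f : ι → Submodule K V) (a : ℕ)
    (h : ∀ i ∈ S, Module.finrank K (f i) ≤ a) :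
    Module.finrank K (S.sup f : Submodule K V) ≤ S.card * a := by
  classical
  induction S using Finset.induction_on with
  | empty => simp
  | insert i S hi ih =>
    rw [Finset.sup_insert, Finset.card_insert_of_notMem hi, add_mul, one_mul]
    have h1 := Submodule.finrank_add_le_finrank_add_finrank (f i) (S.sup f)
    have h2 := h i (Finset.mem_insert_self i S)
    have h3 := ih fun j hj => h j (Finset.mem_insert_of_mem hj)
    omega

theorem Submodule.finrank_le_finrank_finsetInf_add {K V ι : Type*} [Field K] [AddCommGroup V]
    [Module K V] [FiniteDimensional K V] (S : Finset ι) (f : ι → Submodule K V) (a : ℕ)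
    (h : ∀ i ∈ S, Module.finrank K V ≤ Module.finrank K (f i) + a) :
    Module.finrank K V ≤ Module.finrank K (S.inf f : Submodule K V) + S.card * a := by
  classical
  induction S using Finset.induction_on with
  | empty =>
    change Module.finrank K V ≤ Module.finrank K (⊤ : Submodule K V) + _
    rw [finrank_top]
    exact Nat.le_add_right _ _
  | insert i S hi ih =>
    rw [Finset.inf_insert, Finset.card_insert_of_notMem hi, add_mul, one_mul]
    have h1 := Submodule.finrank_sup_add_finrank_inf_eq (f i) (S.inf f)
    have h2 := h i (Finset.mem_insert_self i S)
    have h3 := ih fun j hj => h j (Finset.mem_insert_of_mem hj)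
    have h4 := Submodule.finrank_le (f i ⊔ S.inf f)
    omega

theorem Submodule.exists_basis_adapted {K : Type*} [Field K] {d : ℕ}
    (W : Submodule K (Fin d → K)) :
    ∃ b : Module.Basis (Fin d) K (Fin d → K),
      (∀ i : Fin d, (i : ℕ) < Module.finrank K W → b i ∈ W) ∧
      ∀ v ∈ W, ∀ i : Fin d, Module.finrank K W ≤ i → b.repr v i = 0 := by
  obtain ⟨U, hU⟩ := W.exists_isCompl
  have hd := Submodule.finrank_add_eq_of_isCompl hU
  rw [Module.finrank_fin_fun] at hd
  let c := ((Module.finBasis K W).prod (Module.finBasis K U)).map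
    (Submodule.prodEquivOfIsCompl W U hU)
  let e := finSumFinEquiv.trans (finCongr hd)
  have hl : ∀ i : Fin d, (i : ℕ) < Module.finrank K W → ∃ j, e.symm i = Sum.inl j := by
    intro i hi
    refine ⟨⟨i, hi⟩, e.symm_apply_eq.2 ?_⟩
    ext; simp [e]
  have hr : ∀ i : Fin d, Module.finrank K W ≤ i → ∃ j, e.symm i = Sum.inr j := by
    intro i hi
    refine ⟨⟨i - Module.finrank K W, by omega⟩, e.symm_apply_eq.2 ?_⟩
    ext; simp [e]; omega
  refine ⟨c.reindex e, fun i hi => ?_, fun v hv i hi => ?_⟩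
  · obtain ⟨j, hj⟩ := hl i hi
    simp [hj, c]
  · obtain ⟨j, hj⟩ := hr i hi
    have := (Submodule.prodEquivOfIsCompl_symm_apply_snd_eq_zero W U hU).2 hv
    rw [Module.Basis.repr_reindex_apply, hj, Module.Basis.map_repr, LinearEquiv.trans_apply,
      Module.Basis.prod_repr_inr, this, map_zero, Finsupp.zero_apply]

/-! ### The irreducible strata -/

/-- The idempotent diagonal matrix with `s` leading ones. -/
def leadingIdempotent (d s : ℕ) (A : Type*) [CommRing A] : Matrix (Fin d) (Fin d) A :=
  Matrix.diagonal fun i => if (i : ℕ) < s then 1 else 0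

theorem leadingIdempotent_map {A B : Type*} [CommRing A] [CommRing B] (d s : ℕ) (f : A →+* B) :
    (leadingIdempotent d s A).map f = leadingIdempotent d s B := by
  rw [leadingIdempotent, Matrix.diagonal_map (map_zero f)]
  congr 1
  ext i
  split_ifs <;> simp [*]

theorem leadingIdempotent_mul_self {A : Type*} [CommRing A] (d s : ℕ) :
    leadingIdempotent d s A * leadingIdempotent d s A = leadingIdempotent d s A := by
  rw [leadingIdempotent, Matrix.diagonal_mul_diagonal]
  congr 1
  ext i
  split_ifs <;> simp

theorem one_sub_leadingIdempotent {A : Type*} [CommRing A] (d s : ℕ) :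
    1 - leadingIdempotent d s A =
      Matrix.diagonal fun i : Fin d => if (i : ℕ) < s then 0 else 1 := by
  rw [leadingIdempotent, ← Matrix.diagonal_one, Matrix.diagonal_sub]
  congr 1
  ext i
  split_ifs <;> simp [*]

theorem rank_leadingIdempotent_le {K : Type*} [Field K] (d s : ℕ) :
    (leadingIdempotent d s K).rank ≤ s := by
  classical
  rw [leadingIdempotent, Matrix.rank_diagonal]
  let f : {i : Fin d // (if (i : ℕ) < s then (1 : K) else 0) ≠ 0} → Fin s :=
    fun i => ⟨i.1, by by_contra h; exact i.2 (if_neg h)⟩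
  have hf : Function.Injective f := fun i j h => Subtype.ext (Fin.ext (Fin.mk.inj h))
  simpa using Fintype.card_le_of_injective f hf

theorem rank_one_sub_leadingIdempotent_le {K : Type*} [Field K] (d s : ℕ) :
    (1 - leadingIdempotent d s K).rank ≤ d - s := by
  classical
  rw [one_sub_leadingIdempotent, Matrix.rank_diagonal]
  have hlt : ∀ i : {i : Fin d // (if (i : ℕ) < s then (0 : K) else 1) ≠ 0}, s ≤ (i.1 : ℕ) :=
    fun i => by by_contra h; exact i.2 (if_pos (not_le.1 h))
  let f : {i : Fin d // (if (i : ℕ) < s then (0 : K) else 1) ≠ 0} → Fin (d - s) :=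
    fun i => ⟨i.1 - s, by have := hlt i; have := i.1.2; omega⟩
  have hf : Function.Injective f := fun i j h => by
    have h1 := hlt i
    have h2 := hlt j
    have h3 := Fin.mk.inj h
    exact Subtype.ext (Fin.ext (by omega))
  simpa using Fintype.card_le_of_injective f hf

/-- The conjugate, up to the factor `det g`, of the strictly block triangular part of `y`. -/
def blockConjugate {A : Type*} [CommRing A] {d : ℕ} (s : ℕ) (g y : Matrix (Fin d) (Fin d) A) :
    Matrix (Fin d) (Fin d) A :=
  g * leadingIdempotent d s A * y * ((1 - leadingIdempotent d s A) * g.adjugate)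

theorem blockConjugate_map {A B : Type*} [CommRing A] [CommRing B] {d : ℕ} (s : ℕ) (f : A →+* B)
    (g y : Matrix (Fin d) (Fin d) A) :
    (blockConjugate s g y).map f = blockConjugate s (g.map f) (y.map f) := by
  have h1 := leadingIdempotent_map d s f
  have h2 := f.map_adjugate g
  simp only [← RingHom.mapMatrix_apply] at *
  simp only [blockConjugate, map_mul, map_sub, map_one, h1, h2]

/-- The inner factor is `(1 - E) * (det g • 1) * E = 0`. Invertibility of `g` plays no role, so the
parameter space is a full affine space. -/
theorem blockConjugate_mul_blockConjugate {A : Type*} [CommRing A] {d : ℕ} (s : ℕ)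
    (g y z : Matrix (Fin d) (Fin d) A) : blockConjugate s g y * blockConjugate s g z = 0 := by
  set E := leadingIdempotent d s A with hE
  have h : (1 - E) * g.adjugate * (g * E) = 0 := by
    rw [Matrix.mul_assoc, ← Matrix.mul_assoc g.adjugate, Matrix.adjugate_mul, Matrix.smul_mul,
      Matrix.one_mul, Matrix.mul_smul, Matrix.sub_mul, Matrix.one_mul,
      hE, leadingIdempotent_mul_self, sub_self, smul_zero]
  calc blockConjugate s g y * blockConjugate s g z
      = g * E * y * ((1 - E) * g.adjugate * (g * E)) * (z * ((1 - E) * g.adjugate)) := by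
        simp only [blockConjugate, ← hE, Matrix.mul_assoc]
    _ = 0 := by rw [h]; simp

/-- The points of `Rep_d` obtained by conjugating strictly block triangular matrices whose
image lies in, and whose kernel contains, a fixed `s`-dimensional coordinate subspace. -/
def blockParam {K : Type*} [Field K] (r d s : ℕ)
    (p : (Fin d × Fin d) ⊕ (Fin r × Fin d × Fin d) → K) :
    ModuleVariety (lengthTwoIdeal K r) d :=
  ⟨fun k => blockConjugate s (Matrix.of fun i j => p (Sum.inl (i, j)))
      (Matrix.of fun i j => p (Sum.inr (k, i, j))),
    (forall_mem_lengthTwoIdeal_lift_eq_zero_iff _).2 fun _ _ =>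
      blockConjugate_mul_blockConjugate _ _ _ _⟩

theorem isIrreducible_range_blockParam {K : Type*} [Field K] [Infinite K] (r d s : ℕ) :
    IsIrreducible (Set.range (blockParam (K := K) r d s)) := by
  let _ := zariskiTopology ((Fin d × Fin d) ⊕ (Fin r × Fin d × Fin d)) K
  let _ := zariskiTopology (Fin r × Fin d × Fin d) K
  have hcont : Continuous (blockParam (K := K) r d s) := by
    refine continuous_induced_rng.2 ?_
    let P : Fin r × Fin d × Fin d →
        MvPolynomial ((Fin d × Fin d) ⊕ (Fin r × Fin d × Fin d)) K := fun t =>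
      blockConjugate s (Matrix.of fun i j => MvPolynomial.X (Sum.inl (i, j)))
        (Matrix.of fun i j => MvPolynomial.X (Sum.inr (t.1, i, j))) t.2.1 t.2.2
    convert continuous_aeval_zariskiTopology P using 1
    ext p t
    change blockConjugate s _ _ _ _ = (MvPolynomial.aeval p).toRingHom (P t)
    rw [← Matrix.map_apply (f := (MvPolynomial.aeval p).toRingHom), blockConjugate_map]
    congr 2 <;> · ext; simp
  rw [← Set.image_univ]
  exact (isIrreducible_univ_zariskiTopology _ K).image _ hcont.continuousOn

theorem mem_range_blockParam {K : Type*} [Field K] {r d s : ℕ}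
    (x : ModuleVariety (lengthTwoIdeal K r) d) (W : Submodule K (Fin d → K))
    (hW : Module.finrank K W = s) (hrange : ∀ k v, (x.1 k).mulVec v ∈ W)
    (hker : ∀ k, ∀ v ∈ W, (x.1 k).mulVec v = 0) : x ∈ Set.range (blockParam r d s) := by
  obtain ⟨b, hbW, hbr⟩ := W.exists_basis_adapted
  rw [hW] at hbW hbr
  set g : Matrix (Fin d) (Fin d) K := (Pi.basisFun K (Fin d)).toMatrix b with hg
  set h : Matrix (Fin d) (Fin d) K := b.toMatrix (Pi.basisFun K (Fin d))
  have hgh : g * h = 1 := Module.Basis.toMatrix_mul_toMatrix_flip _ _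
  have hdet : g.det ≠ 0 := left_ne_zero_of_mul (b := h.det) (by rw [← Matrix.det_mul, hgh]; simp)
  have hadj : g.adjugate = g.det • h := by
    calc g.adjugate = g.adjugate * (g * h) := by rw [hgh, Matrix.mul_one]
      _ = _ := by rw [← Matrix.mul_assoc, Matrix.adjugate_mul, Matrix.smul_mul, Matrix.one_mul]
  set E := leadingIdempotent d s K with hE
  have hhv : ∀ v, h.mulVec v = b.repr v := by
    intro v
    have := (Pi.basisFun K (Fin d)).toMatrix_mulVec_repr b v
    rw [← this]
    congr 1
  have hleft : ∀ k, (1 - E) * (h * x.1 k) = 0 := by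
    intro k
    refine Matrix.ext_of_mulVec_single fun j => ?_
    rw [← Matrix.mulVec_mulVec, ← Matrix.mulVec_mulVec, hhv, one_sub_leadingIdempotent]
    ext i
    rw [Matrix.mulVec_diagonal, Matrix.zero_mulVec]
    split_ifs with hi
    · simp
    · rw [hbr _ (hrange k _) i (not_lt.1 hi)]
      simp
  have hright : ∀ k, x.1 k * (g * E) = 0 := by
    intro k
    ext i j
    rw [← Matrix.mul_assoc, hE, leadingIdempotent, Matrix.mul_diagonal]
    split_ifs with hj
    · have := congr_fun (hker k (b j) (hbW j hj)) i
      simpa [Matrix.mulVec, dotProduct, Matrix.mul_apply, hg, Module.Basis.toMatrix_apply]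
        using this
    · simp
  -- The scalar `(g.det)⁻¹` cancels the determinant introduced by the adjugate.
  refine ⟨Sum.elim (fun t => g t.1 t.2)
    (fun t => ((g.det)⁻¹ • (h * x.1 t.1 * g)) t.2.1 t.2.2), Subtype.ext (funext fun k => ?_)⟩
  change g * E * ((g.det)⁻¹ • (h * x.1 k * g)) * ((1 - E) * g.adjugate) = x.1 k
  have h1 : E * (h * x.1 k) = h * x.1 k := by
    have := hleft k
    rwa [Matrix.sub_mul, Matrix.one_mul, sub_eq_zero, eq_comm] at this
  have h2 : x.1 k * (g * (1 - E)) = x.1 k * g := by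
    rw [Matrix.mul_sub, Matrix.mul_one, Matrix.mul_sub, hright, sub_zero]
  calc g * E * ((g.det)⁻¹ • (h * x.1 k * g)) * ((1 - E) * g.adjugate)
      = ((g.det)⁻¹ * g.det) • (g * (E * (h * x.1 k)) * g * ((1 - E) * h)) := by
        rw [hadj]
        simp only [Matrix.mul_smul, Matrix.smul_mul, smul_smul, Matrix.mul_assoc, mul_comm]
    _ = (g * h) * (x.1 k * (g * (1 - E))) * h := by
        rw [inv_mul_cancel₀ hdet, one_smul, h1]
        simp only [Matrix.mul_assoc]
    _ = x.1 k := by rw [hgh, h2, Matrix.one_mul, Matrix.mul_assoc, hgh, Matrix.mul_one]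

theorem ModuleVariety.mul_eq_zero {K : Type*} [Field K] {r d : ℕ}
    (x : ModuleVariety (lengthTwoIdeal K r) d) (k l : Fin r) : x.1 k * x.1 l = 0 :=
  (forall_mem_lengthTwoIdeal_lift_eq_zero_iff _).1 x.2 k l

/-! ### The strata cover -/

theorem exists_mem_range_blockParam {K : Type*} [Field K] {r d c : ℕ} (hc : 2 * c ≤ d)
    (hcmin : ∀ m, d ≤ m * (r + 1) → c ≤ m) (x : ModuleVariety (lengthTwoIdeal K r) d) :
    ∃ s ∈ Finset.Icc c (d - c), x ∈ Set.range (blockParam r d s) := by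
  let f : Fin r → Module.End K (Fin d → K) := fun k => (x.1 k).mulVecLin
  let R : Submodule K (Fin d → K) := Finset.univ.sup fun k => LinearMap.range (f k)
  let N : Submodule K (Fin d → K) := Finset.univ.inf fun k => LinearMap.ker (f k)
  have hfR : ∀ k, LinearMap.range (f k) ≤ R := fun k =>
    Finset.le_sup (f := fun k => LinearMap.range (f k)) (Finset.mem_univ k)
  have hfN : ∀ k, N ≤ LinearMap.ker (f k) := fun k =>
    Finset.inf_le (f := fun k => LinearMap.ker (f k)) (Finset.mem_univ k)
  have hRN : R ≤ N := by
    refine Finset.sup_le fun k _ => Finset.le_inf fun l _ => ?_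
    rintro _ ⟨v, rfl⟩
    simp [f, x.mul_eq_zero]
  have hRN' := Submodule.finrank_mono hRN
  have hNd : Module.finrank K N ≤ d := by simpa using Submodule.finrank_le N
  have hrk : ∀ k, Module.finrank K (LinearMap.range (f k)) +
      Module.finrank K (LinearMap.ker (f k)) = d := fun k => by
    simpa using (f k).finrank_range_add_finrank_ker
  have hR : Module.finrank K R ≤ r * (d - Module.finrank K N) := by
    have := Submodule.finrank_finsetSup_le Finset.univ (fun k => LinearMap.range (f k))
      (d - Module.finrank K N) fun k _ => by
        have := hrk k
        have := Submodule.finrank_mono (hfN k)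
        omega
    simpa using this
  have hN : d ≤ Module.finrank K N + r * Module.finrank K R := by
    have := Submodule.finrank_le_finrank_finsetInf_add Finset.univ
      (fun k => LinearMap.ker (f k)) (Module.finrank K R) fun k _ => by
        have := hrk k
        have := Submodule.finrank_mono (hfR k)
        simp only [Module.finrank_fin_fun]
        omega
    simpa using this
  set a := Module.finrank K R
  set n := Module.finrank K N
  -- From `a ≤ n` and `d ≤ n + r * a` follows `d ≤ n * (r + 1)`; the bound on `d - a` is dual.
  have hcn : c ≤ n := hcmin n (by nlinarith)
  have hca : c ≤ d - a := by
    refine hcmin _ ?_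
    have : r * (d - n) ≤ r * (d - a) := Nat.mul_le_mul_left r (by omega)
    have : (d - a) * (r + 1) = r * (d - a) + (d - a) := by ring
    omega
  obtain ⟨W, hRW, hWN, hW⟩ := Submodule.exists_le_le_finrank_eq hRN (s := max a c)
    (le_max_left _ _) (max_le hRN' hcn)
  refine ⟨max a c, Finset.mem_Icc.2 ⟨le_max_right _ _, max_le (by omega) (by omega)⟩,
    mem_range_blockParam x W hW (fun k v => hRW (hfR k ⟨v, rfl⟩)) fun k v hv => ?_⟩
  exact LinearMap.mem_ker.1 (hfN k (hWN hv))

/-! ### Separating the strata by minors -/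

theorem Matrix.det_eq_zero_of_rank_lt {K : Type*} [Field K] {n : ℕ} (A : Matrix (Fin n) (Fin n) K)
    (h : A.rank < n) : A.det = 0 := by
  by_contra hA
  have := Matrix.rank_of_isUnit A ((Matrix.isUnit_iff_isUnit_det A).2 (isUnit_iff_ne_zero.2 hA))
  rw [Fintype.card_fin] at this
  omega

/-- All `x k` share the left factor `g * E`, so any minor of the side-by-side matrix factors through
rank at most `s`. For the stacked matrix the shared factor is `(1 - E) * g.adjugate`, on the right.
-/
theorem det_coords_eq_zero_of_lt {K : Type*} [Field K] {r d s n : ℕ} (hs : s < n)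
    (p : (Fin d × Fin d) ⊕ (Fin r × Fin d × Fin d) → K)
    (row : Fin n → Fin d) (col : Fin n → Fin r × Fin d) :
    (Matrix.of fun i j =>
      (blockParam r d s p).coords ((col j).1, row i, (col j).2)).det = 0 := by
  refine Matrix.det_eq_zero_of_rank_lt _ ?_
  set g : Matrix (Fin d) (Fin d) K := Matrix.of fun i j => p (Sum.inl (i, j))
  let B : Matrix (Fin d) (Fin n) K := Matrix.of fun l j =>
    ((Matrix.of fun i j' => p (Sum.inr ((col j).1, i, j'))) *
      ((1 - leadingIdempotent d s K) * g.adjugate)) l (col j).2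
  have : (Matrix.of fun i j => (blockParam r d s p).coords ((col j).1, row i, (col j).2)) =
      g.submatrix row id * leadingIdempotent d s K * B := by
    ext i j
    change (g * leadingIdempotent d s K * (Matrix.of fun i j' => p (Sum.inr ((col j).1, i, j'))) *
      ((1 - leadingIdempotent d s K) * g.adjugate)) (row i) (col j).2 = _
    rw [Matrix.mul_assoc, Matrix.mul_apply, Matrix.mul_apply]
    rfl
  rw [this]
  exact ((Matrix.rank_mul_le_left _ _).trans (Matrix.rank_mul_le_right _ _)).trans_lt
    ((rank_leadingIdempotent_le d s).trans_lt hs)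

theorem det_coords_eq_zero_of_sub_lt {K : Type*} [Field K] {r d s n : ℕ} (hs : d - s < n)
    (p : (Fin d × Fin d) ⊕ (Fin r × Fin d × Fin d) → K)
    (row : Fin n → Fin r × Fin d) (col : Fin n → Fin d) :
    (Matrix.of fun i j =>
      (blockParam r d s p).coords ((row i).1, (row i).2, col j)).det = 0 := by
  refine Matrix.det_eq_zero_of_rank_lt _ ?_
  set g : Matrix (Fin d) (Fin d) K := Matrix.of fun i j => p (Sum.inl (i, j))
  let B : Matrix (Fin n) (Fin d) K := Matrix.of fun i l =>
    (g * leadingIdempotent d s K * (Matrix.of fun i' j => p (Sum.inr ((row i).1, i', j))))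
      (row i).2 l
  have : (Matrix.of fun i j => (blockParam r d s p).coords ((row i).1, (row i).2, col j)) =
      B * ((1 - leadingIdempotent d s K) * g.adjugate.submatrix id col) := by
    ext i j
    change (g * leadingIdempotent d s K * (Matrix.of fun i' j => p (Sum.inr ((row i).1, i', j))) *
      ((1 - leadingIdempotent d s K) * g.adjugate)) (row i).2 (col j) = _
    rw [Matrix.mul_apply, Matrix.mul_apply]
    rfl
  rw [this]
  exact ((Matrix.rank_mul_le_right _ _).trans (Matrix.rank_mul_le_left _ _)).trans_lt
    ((rank_one_sub_leadingIdempotent_le d s).trans_lt hs)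

theorem exists_blockParam_coords_eq {K : Type*} [Field K] {r d s : ℕ}
    (y : Fin r × Fin d × Fin d → K) :
    ∃ x ∈ Set.range (blockParam r d s), ∀ k (i j : Fin d), (i : ℕ) < s → s ≤ (j : ℕ) →
      ModuleVariety.coords x (k, i, j) = y (k, i, j) := by
  refine ⟨_, ⟨Sum.elim (fun t => (1 : Matrix (Fin d) (Fin d) K) t.1 t.2) y, rfl⟩, ?_⟩
  intro k i j hi hj
  change ((1 : Matrix (Fin d) (Fin d) K) * leadingIdempotent d s K *
    (Matrix.of fun i j => y (k, i, j)) * ((1 - leadingIdempotent d s K) *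
      (1 : Matrix (Fin d) (Fin d) K).adjugate)) i j = _
  rw [Matrix.adjugate_one, Matrix.mul_one, Matrix.one_mul, one_sub_leadingIdempotent,
    leadingIdempotent, Matrix.mul_diagonal, Matrix.diagonal_mul]
  simp [hi, hj]

/-- A point of the `s`-th stratum for which the sum of the images has dimension `s` and the
intersection of the kernels has dimension `s`, as witnessed by nonzero maximal minors. -/
theorem exists_blockParam_det_eq_one {K : Type*} [Field K] {r d s : ℕ} (hr : 0 < r)
    (hs0 : 0 < s) (hsd : s < d) (h1 : s ≤ r * (d - s)) (h2 : d - s ≤ r * s) :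
    ∃ x ∈ Set.range (blockParam (K := K) r d s),
      (∃ (row : Fin s → Fin d) (col : Fin s → Fin r × Fin d),
        (Matrix.of fun i j => x.coords ((col j).1, row i, (col j).2)).det = 1) ∧
      ∃ (row : Fin (d - s) → Fin r × Fin d) (col : Fin (d - s) → Fin d),
        (Matrix.of fun i j => x.coords ((row i).1, (row i).2, col j)).det = 1 := by
  rcases le_total s (d - s) with h | h
  -- The upper right `s × (d - s)` blocks, stacked over `k`, start with an identity of size `d - s`;
  -- `h2` supplies enough rows. Block `0` alone contains the identity of size `s`.
  · obtain ⟨x, hx, hxy⟩ := exists_blockParam_coords_eq (K := K) (r := r) (d := d) (s := s)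
      fun t => if (t.2.2 : ℕ) = s + (t.1 * s + t.2.1) then 1 else 0
    refine ⟨x, hx, ⟨fun i => ⟨i, by omega⟩, fun j => (⟨0, hr⟩, ⟨s + j, by omega⟩), ?_⟩,
      fun i => (⟨i / s, Nat.div_lt_of_lt_mul (by rw [mul_comm]; omega)⟩,
        ⟨i % s, (Nat.mod_lt _ hs0).trans hsd⟩), fun j => ⟨s + j, by omega⟩, ?_⟩
    · convert Matrix.det_one (n := Fin s)
      ext i j
      rw [Matrix.of_apply, hxy _ _ _ i.2 (Nat.le_add_right _ _), Matrix.one_apply]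
      simp [Fin.ext_iff, eq_comm]
    · convert Matrix.det_one (n := Fin (d - s))
      ext i j
      rw [Matrix.of_apply, hxy _ _ _ (Nat.mod_lt _ hs0) (Nat.le_add_right _ _), Matrix.one_apply]
      simp [Fin.ext_iff, Nat.div_add_mod', eq_comm]
  · have hn : 0 < d - s := by omega
    -- Transposed pattern: the blocks side by side start with an identity of size `s`, by `h1`.
    obtain ⟨x, hx, hxy⟩ := exists_blockParam_coords_eq (K := K) (r := r) (d := d) (s := s)
      fun t => if (t.2.1 : ℕ) = t.1 * (d - s) + (t.2.2 - s) then 1 else 0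
    refine ⟨x, hx, ⟨fun i => ⟨i, by omega⟩,
      fun j => (⟨j / (d - s), Nat.div_lt_of_lt_mul (by rw [mul_comm]; omega)⟩,
        ⟨s + j % (d - s), by have := Nat.mod_lt j hn; omega⟩), ?_⟩,
      fun i => (⟨0, hr⟩, ⟨i, by omega⟩), fun j => ⟨s + j, by omega⟩, ?_⟩
    · convert Matrix.det_one (n := Fin s)
      ext i j
      rw [Matrix.of_apply, hxy _ _ _ i.2 (Nat.le_add_right _ _), Matrix.one_apply]
      simp [Fin.ext_iff, Nat.div_add_mod']
    · convert Matrix.det_one (n := Fin (d - s))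
      ext i j
      rw [Matrix.of_apply, hxy _ _ _ (i.2.trans_le h) (Nat.le_add_right _ _), Matrix.one_apply]
      simp [Fin.ext_iff]

theorem eq_of_range_blockParam_subset_closure {K : Type*} [Field K] {r d s t : ℕ} (hr : 0 < r)
    (hs0 : 0 < s) (hsd : s < d) (h1 : s ≤ r * (d - s)) (h2 : d - s ≤ r * s)
    (h : Set.range (blockParam (K := K) r d s) ⊆ closure (Set.range (blockParam r d t))) :
    s = t := by
  obtain ⟨x, hx, ⟨row, col, hC⟩, ⟨row', col', hD⟩⟩ :=
    exists_blockParam_det_eq_one (K := K) hr hs0 hsd h1 h2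
  rcases lt_trichotomy s t with hst | hst | hst
  · have hsub := closure_minimal (s := Set.range (blockParam (K := K) r d t))
      (by
        rintro _ ⟨p, rfl⟩
        exact det_coords_eq_zero_of_sub_lt (by omega) p row' col')
      (isClosed_setOf_det_coords_eq_zero (lengthTwoIdeal K r)
        fun i j => ((row' i).1, (row' i).2, col' j))
    exact absurd (hD.symm.trans (hsub (h hx))) one_ne_zero
  · exact hst
  · have hsub := closure_minimal (s := Set.range (blockParam (K := K) r d t))
      (by
        rintro _ ⟨p, rfl⟩
        exact det_coords_eq_zero_of_lt hst p row col)
      (isClosed_setOf_det_coords_eq_zero (lengthTwoIdeal K r)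
        fun i j => ((col j).1, row i, (col j).2))
    exact absurd (hC.symm.trans (hsub (h hx))) one_ne_zero

/-! ### Counting the strata -/

theorem corollary3p13 {K : Type*} [Field K] [IsAlgClosed K] (r : ℕ) (hr : 2 ≤ r)
    (d : ℕ) (hd : 2 ≤ d) :
    (irreducibleComponents (ModuleVariety (lengthTwoIdeal K r) d)).Finite ∧
    ((irreducibleComponents (ModuleVariety (lengthTwoIdeal K r) d)).ncard : ℤ) =
      (d : ℤ) - 2 * ⌈(d : ℚ) / ((r : ℚ) + 1)⌉ + 1 := by
  have : Infinite K := IsAlgClosed.instInfinite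
  set c := ⌈(d : ℚ) / ((r : ℚ) + 1)⌉₊ with hcdef
  have hceil : ⌈(d : ℚ) / ((r : ℚ) + 1)⌉ = (c : ℤ) :=
    (Int.natCast_ceil_eq_ceil (by positivity)).symm
  have hcle : ∀ m : ℕ, c ≤ m ↔ d ≤ m * (r + 1) := by
    intro m
    rw [hcdef, Nat.ceil_le, div_le_iff₀ (by positivity)]
    exact_mod_cast Iff.rfl
  have hcd := (hcle c).1 le_rfl
  have hc0 : 0 < c := by
    by_contra h
    have := (hcle 0).1 (by omega)
    omega
  have h2c : 2 * c ≤ d := by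
    have hle : c ≤ d / 2 := by
      refine (hcle _).2 ?_
      -- Here `r ≥ 2` enters; moreover `d ≤ 3 * (d / 2)` because `d ≥ 2`.
      have : d / 2 * 3 ≤ d / 2 * (r + 1) := Nat.mul_le_mul_left _ (by omega)
      omega
    omega
  obtain ⟨hfin, hcard⟩ := ncard_irreducibleComponents_eq_card (Finset.Icc c (d - c))
    (fun s => Set.range (blockParam (K := K) r d s))
    (fun s _ => isIrreducible_range_blockParam r d s)
    (exists_mem_range_blockParam h2c fun m => (hcle m).2)
    (fun s hs t _ h => by
      rw [Finset.mem_Icc] at hs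
      have h1 := (hcle s).1 hs.1
      have h2 := (hcle (d - s)).1 (by omega)
      rw [Nat.mul_succ, mul_comm] at h1 h2
      exact eq_of_range_blockParam_subset_closure (by omega) (by omega) (by omega) (by omega)
        (by omega) h)
  refine ⟨hfin, ?_⟩
  rw [hcard, Nat.card_Icc, hceil]
  -- The truncated `d - c + 1 - c` is a true difference thanks to `h2c`.
  omega
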